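/- A shared object type $T$ is given by a set of states, a set of operations and a sequential specification saying, for each state and operation, which responses and new states are possible. It is deterministic if each operation applied in each state yields a unique response and a unique new state, and readable if it has an operation that returns the entire state of the object without altering it. Consider $n$ asynchronous processes, each with a fixed input from a set $V$ with at least two elements, that communicate by atomic operations on any (possibly infinite) number of shared objects of type $T$ and read/write registers, all suitably initialized. An algorithm solves (wait-free) consensus if, in every execution in which processes may halt but do not recover, no two outputs differ, each output is the input of some process, and each process that keeps taking steps outputs a value after finitely many of its own steps. It solves recoverable consensus (with independent crashes) if the same holds in executions in which each process may, at any time and any number of times, independently of the others, crash and restart its code from the beginning, keeping its input but losing its local state, while the shared objects are unaffected by crashes: no two outputs (including those of different runs of the same process) differ, each output is the input of some process, and each run of a process crashes or outputs a value after finitely many of its own steps. The consensus number $\mathrm{cons}(T)$ (respectively the RC number $\mathrm{rcons}(T)$) is the maximum number of processes for which some algorithm using objects of type $T$ and registers solves consensus (respectively recoverable consensus), or $\infty$ if there is no maximum. **Corollary.** For every $n \ge 4$ there is a deterministic, readable type $T_n$ such that, for every set $V$ of possible inputs with at least two elements, $$\mathrm{rcons}(T_n) < \mathrm{cons}(T_n)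 = n .$$ -/

import Mathlib

/-- A shared object type, given by its sequential specification: `spec q op r q'` says that applying
the operation `op` (name and arguments) to an object in state `q` may return the response `r` and
leave the object in state `q'`. Every operation can be applied in every state. -/
structure ObjType where
  State : Type
  Op : Type
  Resp : Type
  spec : State → Op → Resp → State → Prop
  total : ∀ q op, ∃ r q', spec q op r q'

/-- A type is deterministic if the state and the operation determine a unique response and a unique
new state. -/
def ObjType.Deterministic (T : ObjType) : Prop :=
  ∀ q op, ∃! p : T.Resp × T.State, T.spec q op p.1 p.2

/-- A type is readable if it has an operation that returns the entire state of the object (through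
an injective encoding of states as responses) and does not alter the state. -/
def ObjType.Readable (T : ObjType) : Prop :=
  ∃ (rd : T.Op) (enc : T.State → T.Resp), Function.Injective enc ∧
    ∀ q r q', T.spec q rd r q' ↔ r = enc q ∧ q' = q

/-- What a process does next, as a function of its local state: output a value (and end its run),
apply an operation to a shared object of type `T`, read a register, or write a register. The
remaining argument is the local state in which the process continues. -/
inductive Command (V : Type) (T : ObjType) (Obj Reg Val Loc : Type) : Type
  | output (v : V)
  | access (o : Obj) (op : T.Op) (k : T.Resp → Loc)
  | read (x : Reg) (k : Val → Loc)
  | write (x : Reg) (a : Val) (l : Loc)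

/-- An algorithm for `n` asynchronous processes with inputs and outputs in `V`. It uses a (possibly
infinite) family `Obj` of shared objects of type `T` and a (possibly infinite) family `Reg` of
read/write registers holding values in `Val`, with initial states of its choice. Process `p` with
input `v` starts each of its runs in the local state `start p v`. -/
structure Algorithm (V : Type) (T : ObjType) (n : ℕ) where
  Obj : Type
  Reg : Type
  Val : Type
  Loc : Type
  initObj : Obj → T.State
  initReg : Reg → Val
  start : Fin n → V → Loc
  code : Fin n → Loc → Command V T Obj Reg Val Loc

/-- The events of an execution: a process takes the next (atomic) step of its code, or a process
crashes and is reset to the beginning of its code. -/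
inductive Event (n : ℕ) : Type
  | step (p : Fin n)
  | crash (p : Fin n)

namespace Algorithm

variable {V : Type} {T : ObjType} {n : ℕ}

/-- A configuration: the states of all shared objects and registers (non-volatile) and the local
states of all processes (volatile). -/
structure Config (A : Algorithm V T n) where
  obj : A.Obj → T.State
  reg : A.Reg → A.Val
  loc : Fin n → A.Loc

/-- The initial configuration for the input assignment `inp`. -/
def init (A : Algorithm V T n) (inp : Fin n → V) : A.Config where
  obj := A.initObj
  reg := A.initReg
  loc := fun p => A.start p (inp p)

open Classical in
/-- The effect of one event. A process that has output a value takes no further step in that run,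
but it may still crash. A crash of `p` resets the local state of `p` only; the input of `p` is the
same in all its runs. -/
inductive Next (A : Algorithm V T n) (inp : Fin n → V) : A.Config → Event n → A.Config → Prop
  | access {c : A.Config} {p : Fin n} {o : A.Obj} {op : T.Op} {k : T.Resp → A.Loc}
      {r : T.Resp} {q : T.State} (hcode : A.code p (c.loc p) = Command.access o op k)
      (hspec : T.spec (c.obj o) op r q) :
      Next A inp c (Event.step p)
        { c with obj := Function.update c.obj o q, loc := Function.update c.loc p (k r) }
  | read {c : A.Config} {p : Fin n} {x : A.Reg} {k : A.Val → A.Loc}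
      (hcode : A.code p (c.loc p) = Command.read x k) :
      Next A inp c (Event.step p)
        { c with loc := Function.update c.loc p (k (c.reg x)) }
  | write {c : A.Config} {p : Fin n} {x : A.Reg} {a : A.Val} {l : A.Loc}
      (hcode : A.code p (c.loc p) = Command.write x a l) :
      Next A inp c (Event.step p)
        { c with reg := Function.update c.reg x a, loc := Function.update c.loc p l }
  | crash (c : A.Config) (p : Fin n) :
      Next A inp c (Event.crash p)
        { c with loc := Function.update c.loc p (A.start p (inp p)) }

/-- `c'` can be reached from `c` by finitely many events, all of them in `E`. -/
def Reach (A : Algorithm V T n) (E : Set (Event n)) (inp : Fin n → V) : A.Config → A.Config → Prop :=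
  Relation.ReflTransGen fun c c' => ∃ e ∈ E, A.Next inp c e c'

/-- In configuration `c`, the current run of process `p` has ended with output `v`. -/
def Outputs (A : Algorithm V T n) (c : A.Config) (p : Fin n) (v : V) : Prop :=
  A.code p (c.loc p) = Command.output v

/-- `A` solves consensus in the executions all of whose events are in `E`. -/
structure Solves (A : Algorithm V T n) (E : Set (Event n)) : Prop where
  /-- No two outputs produced in an execution differ, including outputs of different runs of the
  same process. -/
  agreement : ∀ (inp : Fin n → V) (c c' : A.Config) (p p' : Fin n) (v v' : V),
    A.Reach E inp (A.init inp) c → A.Reach E inp c c' →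
    A.Outputs c p v → A.Outputs c' p' v' → v = v'
  /-- Each output is the input of some process. -/
  validity : ∀ (inp : Fin n → V) (c : A.Config) (p : Fin n) (v : V),
    A.Reach E inp (A.init inp) c → A.Outputs c p v → ∃ p', inp p' = v
  /-- No run consists of infinitely many steps: in an infinite execution, a process that crashes
  only finitely often takes only finitely many steps. -/
  waitFree : ∀ (inp : Fin n → V) (c : ℕ → A.Config) (e : ℕ → Event n),
    c 0 = A.init inp → (∀ t, e t ∈ E ∧ A.Next inp (c t) (e t) (c (t + 1))) →
    ∀ p : Fin n, {t | e t = Event.crash p}.Finite → {t | e t = Event.step p}.Finite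

end Algorithm

/-- Standard wait-free consensus among `n` processes is solvable with objects of type `T` and
registers: no crash-and-recovery occurs, but processes may halt (stop taking steps) at any time. -/
def ConsensusSolvable (V : Type) (T : ObjType) (n : ℕ) : Prop :=
  ∃ A : Algorithm V T n, A.Solves (Set.range Event.step)

/-- Recoverable consensus among `n` processes is solvable with objects of type `T` and registers,
when processes may crash and recover independently, at any time and any number of times. -/
def RecoverableConsensusSolvable (V : Type) (T : ObjType) (n : ℕ) : Prop :=
  ∃ A : Algorithm V T n, A.Solves Set.univ

/-- The consensus number of `T`: the largest number of processes for which consensus is solvable,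
or `⊤` if there is no largest one. -/
noncomputable def cons (V : Type) (T : ObjType) : ℕ∞ :=
  ⨆ (n : ℕ) (_ : ConsensusSolvable V T n), (n : ℕ∞)

/-- The RC number of `T` (for independent crashes): the largest number of processes for which
recoverable consensus is solvable, or `⊤` if there is no largest one. -/
noncomputable def rcons (V : Type) (T : ObjType) : ℕ∞ :=
  ⨆ (n : ℕ) (_ : RecoverableConsensusSolvable V T n), (n : ℕ∞)

/-! ### The type -/

/-! The type remembers who updated it first, but its `n`-th update resets it to the initial state.
If each of `n` processes updates at most once, the reset harms nobody, because no process accesses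
the object afterwards. So announcing the input, updating, and adopting the input of the first
updater solves consensus (`consensusSolvable_winnerType`).

Both impossibility results are valency arguments with a common core,
`Solves.exists_opposed_updates`: some configuration has all processes about to update the same
object in state `none`, and some `p` and `q` whose first steps lead to different decisions. Let `n`
processes, once with `p` first and once with `q` first, take one step each: the shared memory is
restored both times, so no evidence of the winner remains there. With more than `n` processes, a
process that took no step cannot tell the two runs apart. With exactly `n` processes and crashes, a
process that crashes at the end of the run loses its local evidence too.

Unrestricted crashes would allow infinite bivalent executions, so valency is defined over executions
with crash budgets: a step of `p` allows one more crash to every process with a larger index.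
Process `0`, starting with budget zero, never crashes, hence stops; by induction every process
crashes and steps only finitely often (`Solves.not_infinite_budget`). The budgets still permit the
one crash that is needed, that of process `1` after a step of process `0`. -/

/-- The state change of an object that remembers the first of every `n` consecutive updates together
with the number of updates since then, and forgets both with the last of these updates. -/
def winnerNext (n : ℕ) : Option (Fin n × ℕ) → Option (Fin n) → Option (Fin n × ℕ)
  | s, none => s
  | none, some i => some (i, 1)
  | some (w, k), some _ => if k + 1 < n then some (w, k + 1) else none

/-- The type whose operations are a read (`none`) and updates by `n` names (`some i`). Each operation
returns the state in which it was applied. -/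
def winnerType (n : ℕ) : ObjType where
  State := Option (Fin n × ℕ)
  Op := Option (Fin n)
  Resp := Option (Fin n × ℕ)
  spec q op r q' := r = q ∧ q' = winnerNext n q op
  total q op := ⟨q, winnerNext n q op, rfl, rfl⟩

theorem winnerType_deterministic (n : ℕ) : (winnerType n).Deterministic := fun q op =>
  ⟨(q, winnerNext n q op), ⟨rfl, rfl⟩, fun _ h => Prod.ext h.1 h.2⟩

theorem winnerType_readable (n : ℕ) : (winnerType n).Readable :=
  ⟨(none : Option (Fin n)), id, Function.injective_id, fun _ _ _ => Iff.rfl⟩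

/-- After the first update, further ones are only counted. Hence two opposed updates must meet an
object in state `none`. -/
theorem winnerNext_some_eq (n : ℕ) (s : Fin n × ℕ) (i j : Fin n) :
    winnerNext n (some s) (some i) = winnerNext n (some s) (some j) := rfl

/-- The drops make `f` injective on `S`, and its values there are at most `f 0`. -/
theorem Set.finite_of_antitone_of_lt {f : ℕ → ℕ} (hf : Antitone f) {S : Set ℕ}
    (hS : ∀ t ∈ S, f (t + 1) < f t) : S.Finite := by
  refine Set.Finite.of_finite_image (f := f)
    ((Set.finite_Iic (f 0)).subset ?_) ?_
  · rintro _ ⟨t, -, rfl⟩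
    exact hf (Nat.zero_le t)
  · intro a ha b hb hab
    rcases lt_trichotomy a b with h | h | h
    · have := hf (Nat.succ_le_of_lt h)
      have := hS a ha
      simp only [Nat.succ_eq_add_one] at *
      omega
    · exact h
    · have := hf (Nat.succ_le_of_lt h)
      have := hS b hb
      simp only [Nat.succ_eq_add_one] at *
      omega

namespace Algorithm

/-! ### Executions with crash budgets, and valency -/

section Executions

variable {V : Type} {T : ObjType} {m : ℕ}

/-- Wait-freedom in executions that start in an arbitrary reachable configuration. -/
theorem Solves.waitFree_of_reach {A : Algorithm V T m} {E : Set (Event m)} (hA : A.Solves E)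
    {inp : Fin m → V} {c₀ : A.Config} (h₀ : A.Reach E inp (A.init inp) c₀) :
    ∀ (c : ℕ → A.Config) (e : ℕ → Event m), c 0 = c₀ →
      (∀ t, e t ∈ E ∧ A.Next inp (c t) (e t) (c (t + 1))) →
      ∀ p : Fin m, {t | e t = Event.crash p}.Finite → {t | e t = Event.step p}.Finite := by
  induction h₀ with
  | refl => exact hA.waitFree inp
  | tail _ hstep ih =>
    rename_i c₁ c₂ _
    obtain ⟨e₀, he₀, hn⟩ := hstep
    intro c e hc hce p hp
    -- Prepending the last step of the path gives an infinite execution from `c₁`.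
    have key := ih (fun t => Nat.casesOn t c₁ c) (fun t => Nat.casesOn t e₀ e) rfl ?_ p ?_
    · exact key.preimage (f := Nat.succ) (Nat.succ_injective.injOn)
    · rintro (_ | t)
      · exact ⟨he₀, by simpa [hc] using hn⟩
      · exact hce t
    · refine ((Set.finite_singleton 0).union (hp.image Nat.succ)).subset ?_
      rintro (_ | t) ht
      · exact Or.inl rfl
      · exact Or.inr ⟨t, ht, rfl⟩

/-- Two configurations that `r` cannot distinguish: the shared memory and the local state of `r`
are the same. -/
structure SameFor {A : Algorithm V T m} (r : Fin m) (c c' : A.Config) : Prop where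
  obj : c.obj = c'.obj
  reg : c.reg = c'.reg
  loc : c.loc r = c'.loc r

theorem SameFor.symm {A : Algorithm V T m} {r : Fin m} {c c' : A.Config} (h : SameFor r c c') :
    SameFor r c' c := ⟨h.obj.symm, h.reg.symm, h.loc.symm⟩

theorem SameFor.trans {A : Algorithm V T m} {r : Fin m} {c c' c'' : A.Config}
    (h : SameFor r c c') (h' : SameFor r c' c'') : SameFor r c c'' :=
  ⟨h.obj.trans h'.obj, h.reg.trans h'.reg, h.loc.trans h'.loc⟩

/-- The configurations of executions with a budget of crashes for each process. -/
abbrev BudgetConfig (A : Algorithm V T m) : Type := A.Config × (Fin m → ℕ)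

/-- The budgets after a step of `p`: each process after `p` may crash once more. -/
def budgetStep (p : Fin m) (b : Fin m → ℕ) : Fin m → ℕ := fun i => if p < i then b i + 1 else b i

theorem le_budgetStep (p : Fin m) (b : Fin m → ℕ) (i : Fin m) : b i ≤ budgetStep p b i := by
  unfold budgetStep; split <;> omega

/-- The effect of one event in executions with budgets of crashes. -/
def BudgetNext (A : Algorithm V T m) (E : Set (Event m)) (inp : Fin m → V) (x : A.BudgetConfig)
    (e : Event m) (y : A.BudgetConfig) : Prop :=
  e ∈ E ∧ A.Next inp x.1 e y.1 ∧
    match e with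
    | Event.step p => y.2 = budgetStep p x.2
    | Event.crash p => 0 < x.2 p ∧ y.2 = Function.update x.2 p (x.2 p - 1)

/-- Reachability by executions with budgets of crashes. -/
def BudgetReach (A : Algorithm V T m) (E : Set (Event m)) (inp : Fin m → V) :
    A.BudgetConfig → A.BudgetConfig → Prop :=
  Relation.ReflTransGen fun x y => ∃ e, A.BudgetNext E inp x e y

theorem BudgetReach.reach {A : Algorithm V T m} {E : Set (Event m)} {inp : Fin m → V}
    {x y : A.BudgetConfig} (h : A.BudgetReach E inp x y) : A.Reach E inp x.1 y.1 :=
  Relation.ReflTransGen.lift (r := fun x y => ∃ e, A.BudgetNext E inp x e y)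
    (p := fun c c' => ∃ e ∈ E, A.Next inp c e c') Prod.fst
    (fun _ _ ⟨e, he, hn, _⟩ => ⟨e, he, hn⟩) _ _ h

/-- There is no infinite execution with budgets of crashes. -/
theorem Solves.not_infinite_budget {A : Algorithm V T m} {E : Set (Event m)} (hA : A.Solves E)
    {inp : Fin m → V} (x : ℕ → A.BudgetConfig) (e : ℕ → Event m) (h₀ : (x 0).1 = A.init inp)
    (hx : ∀ t, A.BudgetNext E inp (x t) (e t) (x (t + 1))) : False := by
  have fin : ∀ i : Fin m, {t | e t = Event.crash i}.Finite ∧ {t | e t = Event.step i}.Finite := by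
    intro i
    induction i using WellFoundedLT.induction with
    | ind i ih =>
      have hc : {t | e t = Event.crash i}.Finite := by
        -- Only steps of processes below `i` raise the budget of `i`. By induction these end at some
        -- time `N`, after which the budget never grows and each crash of `i` lowers it.
        have hlow : (⋃ j ∈ {j : Fin m | j < i}, {t | e t = Event.step j}).Finite :=
          (Set.toFinite _).biUnion fun j hj => (ih j hj).2
        obtain ⟨N, hN⟩ := hlow.bddAbove
        have hlate : ∀ t j, j < i → e (N + 1 + t) ≠ Event.step j := by
          intro t j hj he
          have : N + 1 + t ≤ N := hN (Set.mem_biUnion (x := j) hj he)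
          omega
        have hle : ∀ t, (x (N + 1 + (t + 1))).2 i ≤ (x (N + 1 + t)).2 i ∧
            (e (N + 1 + t) = Event.crash i →
              (x (N + 1 + (t + 1))).2 i < (x (N + 1 + t)).2 i) := by
          intro t
          obtain ⟨-, -, hb⟩ := hx (N + 1 + t)
          have hl := hlate t
          cases he : e (N + 1 + t) with
          | step j =>
            simp only [he] at hb
            have hj : ¬ j < i := fun hj => hl j hj he
            refine ⟨?_, fun h => by cases h⟩
            change (x (N + 1 + t + 1)).2 i ≤ _
            rw [hb]
            simp [budgetStep, hj]
          | crash j =>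
            simp only [he] at hb
            change (x (N + 1 + t + 1)).2 i ≤ _ ∧ (_ → (x (N + 1 + t + 1)).2 i < _)
            rw [hb.2]
            by_cases hj : j = i
            · subst hj
              have := hb.1
              simp only [Function.update_self]
              exact ⟨by omega, fun _ => by omega⟩
            · refine ⟨by simp [Function.update_of_ne (Ne.symm hj)], fun h => ?_⟩
              exact absurd (by injection h) hj
        have hfin : {t | e (N + 1 + t) = Event.crash i}.Finite :=
          Set.finite_of_antitone_of_lt (f := fun t => (x (N + 1 + t)).2 i)
            (antitone_nat_of_succ_le fun t => (hle t).1) fun t ht => (hle t).2 ht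
        refine ((Set.finite_Iic N).union (hfin.image fun t => N + 1 + t)).subset fun t ht => ?_
        by_cases htN : t ≤ N
        · exact Or.inl htN
        · have h : N + 1 + (t - (N + 1)) = t := by omega
          exact Or.inr ⟨t - (N + 1), by simpa only [Set.mem_ofPred_eq, h] using ht, h⟩
      exact ⟨hc, hA.waitFree inp (fun t => (x t).1) e h₀ (fun t => ⟨(hx t).1, (hx t).2.1⟩) i hc⟩
  refine Set.infinite_univ (α := ℕ) ((Set.finite_iUnion fun i => (fin i).1.union (fin i).2).subset ?_)
  intro t _
  cases he : e t with
  | step i => exact Set.mem_iUnion.2 ⟨i, Or.inr he⟩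
  | crash i => exact Set.mem_iUnion.2 ⟨i, Or.inl he⟩

/-- The value `v` is an output in some continuation of `x`. -/
def CanOutput (A : Algorithm V T m) (E : Set (Event m)) (inp : Fin m → V) (x : A.BudgetConfig)
    (v : V) : Prop :=
  ∃ y, A.BudgetReach E inp x y ∧ ∃ p, A.Outputs y.1 p v

theorem CanOutput.of_reach {A : Algorithm V T m} {E : Set (Event m)} {inp : Fin m → V}
    {x y : A.BudgetConfig} {v : V} (h : A.CanOutput E inp y v) (hxy : A.BudgetReach E inp x y) :
    A.CanOutput E inp x v := by
  obtain ⟨z, hz, hp⟩ := h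
  exact ⟨z, Relation.ReflTransGen.trans hxy hz, hp⟩

/-- Two different values are possible outputs in the continuations of `x`. -/
def Bivalent (A : Algorithm V T m) (E : Set (Event m)) (inp : Fin m → V) (x : A.BudgetConfig) :
    Prop :=
  ∃ v v', v ≠ v' ∧ A.CanOutput E inp x v ∧ A.CanOutput E inp x v'

theorem CanOutput.eq {A : Algorithm V T m} {E : Set (Event m)} {inp : Fin m → V}
    {x : A.BudgetConfig} {v v' : V} (h : A.CanOutput E inp x v) (h' : A.CanOutput E inp x v')
    (hx : ¬ A.Bivalent E inp x) : v = v' :=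
  by_contra fun hne => hx ⟨v, v', hne, h, h'⟩

/-- Otherwise every reachable bivalent configuration has a bivalent successor, and choosing
successors forever yields an infinite execution within the budgets. -/
theorem Solves.exists_critical {A : Algorithm V T m} {E : Set (Event m)} (hA : A.Solves E)
    {inp : Fin m → V} {x₀ : A.BudgetConfig} (h₀ : x₀.1 = A.init inp)
    (hb : A.Bivalent E inp x₀) :
    ∃ x, A.BudgetReach E inp x₀ x ∧ A.Bivalent E inp x ∧
      ∀ e y, A.BudgetNext E inp x e y → ¬ A.Bivalent E inp y := by
  by_contra! hcon
  let S := {x : A.BudgetConfig // A.BudgetReach E inp x₀ x ∧ A.Bivalent E inp x}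
  have hnext : ∀ s : S, ∃ (e : Event m) (s' : S), A.BudgetNext E inp s.1 e s'.1 := by
    rintro ⟨x, hx, hbx⟩
    obtain ⟨e, y, hy, hby⟩ := hcon x hx hbx
    exact ⟨e, ⟨y, hx.tail ⟨e, hy⟩, hby⟩, hy⟩
  choose e s' hs using hnext
  let seq : ℕ → S := fun t => Nat.rec ⟨x₀, Relation.ReflTransGen.refl, hb⟩ (fun _ s => s' s) t
  exact hA.not_infinite_budget (fun t => (seq t).1) (fun t => e (seq t)) h₀ fun t => hs (seq t)

end Executions

/-! ### Deterministic steps, solo runs and critical configurations for `winnerType` -/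

section Winner

variable {V : Type} {n m : ℕ}

open Classical in
/-- The configuration after the next step of `p`; nothing changes if `p` has output a value. -/
noncomputable def advance (A : Algorithm V (winnerType n) m) (p : Fin m) (c : A.Config) :
    A.Config :=
  match A.code p (c.loc p) with
  | Command.output _ => c
  | Command.access o op k =>
    { c with
      obj := Function.update c.obj o (winnerNext n (c.obj o) op)
      loc := Function.update c.loc p (k (c.obj o)) }
  | Command.read x k => { c with loc := Function.update c.loc p (k (c.reg x)) }
  | Command.write x a l =>
    { c with reg := Function.update c.reg x a, loc := Function.update c.loc p l }

variable {A : Algorithm V (winnerType n) m}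

theorem next_step_iff {inp : Fin m → V} {c c' : A.Config} {p : Fin m} :
    A.Next inp c (Event.step p) c' ↔ (∀ v, ¬ A.Outputs c p v) ∧ c' = A.advance p c := by
  constructor
  · intro h
    cases h with
    | access hcode hspec =>
      refine ⟨fun v hv => by (rw [Outputs, hcode] at hv; cases hv), ?_⟩
      obtain ⟨rfl, rfl⟩ := hspec
      simp only [advance, hcode]
    | read hcode =>
      exact ⟨fun v hv => by (rw [Outputs, hcode] at hv; cases hv), by simp only [advance, hcode]⟩
    | write hcode =>
      exact ⟨fun v hv => by (rw [Outputs, hcode] at hv; cases hv), by simp only [advance, hcode]⟩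
  · rintro ⟨hout, rfl⟩
    cases hcode : A.code p (c.loc p) with
    | output v => exact absurd hcode (hout v)
    | access o op k =>
      simp only [advance, hcode]
      exact Next.access hcode ⟨rfl, rfl⟩
    | read x k =>
      simp only [advance, hcode]
      exact Next.read hcode
    | write x a l =>
      simp only [advance, hcode]
      exact Next.write hcode

theorem advance_of_outputs {c : A.Config} {p : Fin m} {v : V} (h : A.Outputs c p v) :
    A.advance p c = c := by
  unfold Outputs at h
  simp only [advance, h]

theorem advance_loc_of_ne {c : A.Config} {p r : Fin m} (h : r ≠ p) :
    (A.advance p c).loc r = c.loc r := by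
  unfold advance
  split <;> simp [Function.update_of_ne h]

theorem SameFor.advance {c c' : A.Config} {r : Fin m} (h : SameFor r c c') :
    SameFor r (A.advance r c) (A.advance r c') := by
  obtain ⟨ho, hr, hl⟩ := h
  unfold Algorithm.advance
  rw [← hl]
  split
  · exact ⟨ho, hr, hl⟩
  · exact ⟨by simp [ho], hr, by simp [ho]⟩
  · exact ⟨ho, hr, by simp [hr]⟩
  · exact ⟨ho, by simp [hr], by simp⟩

theorem SameFor.iterate_advance {c c' : A.Config} {r : Fin m} (h : SameFor r c c') (k : ℕ) :
    SameFor r ((A.advance r)^[k] c) ((A.advance r)^[k] c') := by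
  induction k with
  | zero => exact h
  | succ k ih =>
    simp only [Function.iterate_succ_apply']
    exact ih.advance

/-- The budgeted configuration after a step of `p`. -/
noncomputable def budgetAdvance (A : Algorithm V (winnerType n) m) (p : Fin m)
    (x : A.BudgetConfig) : A.BudgetConfig :=
  (A.advance p x.1, budgetStep p x.2)

variable {E : Set (Event m)} {inp : Fin m → V}

theorem budgetNext_advance (hE : Set.range Event.step ⊆ E) {x : A.BudgetConfig} {p : Fin m}
    (hp : ∀ v, ¬ A.Outputs x.1 p v) :
    A.BudgetNext E inp x (Event.step p) (A.budgetAdvance p x) :=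
  ⟨hE ⟨p, rfl⟩, next_step_iff.2 ⟨hp, rfl⟩, rfl⟩

/-- Solo runs contain no crash, so no budget can block them and the final budgets are irrelevant.
This is why `SameFor` ignores budgets. -/
theorem exists_budgetReach_iterate (hE : Set.range Event.step ⊆ E) (x : A.BudgetConfig)
    (p : Fin m) (k : ℕ) : ∃ b, A.BudgetReach E inp x ((A.advance p)^[k] x.1, b) := by
  induction k with
  | zero => exact ⟨x.2, Relation.ReflTransGen.refl⟩
  | succ k ih =>
    obtain ⟨b, hb⟩ := ih
    rw [Function.iterate_succ_apply']
    by_cases h : ∃ v, A.Outputs ((A.advance p)^[k] x.1) p v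
    · obtain ⟨v, hv⟩ := h
      exact ⟨b, by rwa [advance_of_outputs hv]⟩
    · push Not at h
      exact ⟨budgetStep p b, hb.tail ⟨_, budgetNext_advance hE h⟩⟩

theorem Solves.solo_outputs (hA : A.Solves E) (hE : Set.range Event.step ⊆ E) {c : A.Config}
    (hc : A.Reach E inp (A.init inp) c) (p : Fin m) :
    ∃ k v, A.Outputs ((A.advance p)^[k] c) p v := by
  by_contra! hcon
  have h := hA.waitFree_of_reach hc (fun t => (A.advance p)^[t] c) (fun _ => Event.step p) rfl
    (fun t => ⟨hE ⟨p, rfl⟩, next_step_iff.2 ⟨hcon t, Function.iterate_succ_apply' _ _ _⟩⟩) p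
    (by simp)
  simp only [Set.ofPred_true] at h
  exact Set.infinite_univ h

/-- Two reachable configurations that some process cannot distinguish have a common possible
output. -/
theorem Solves.exists_common_output (hA : A.Solves E) (hE : Set.range Event.step ⊆ E)
    {x y : A.BudgetConfig} (hx : A.Reach E inp (A.init inp) x.1) {r : Fin m}
    (h : SameFor r x.1 y.1) : ∃ w, A.CanOutput E inp x w ∧ A.CanOutput E inp y w := by
  obtain ⟨k, w, hw⟩ := hA.solo_outputs hE hx r
  obtain ⟨b, hb⟩ := exists_budgetReach_iterate (inp := inp) hE x r k
  obtain ⟨b', hb'⟩ := exists_budgetReach_iterate (inp := inp) hE y r k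
  refine ⟨w, ⟨_, hb, r, hw⟩, ⟨_, hb', r, ?_⟩⟩
  have := (h.iterate_advance k).loc
  unfold Outputs at hw ⊢
  rwa [← this]

/-- Running alone, `p` cannot see the inputs of the others; if all of them equalled its own,
validity would force this output. -/
theorem Solves.canOutput_input (hA : A.Solves E) (hE : Set.range Event.step ⊆ E) (b : Fin m → ℕ)
    (p : Fin m) : A.CanOutput E inp (A.init inp, b) (inp p) := by
  obtain ⟨k, w, hw⟩ := hA.solo_outputs hE (inp := fun _ => inp p) Relation.ReflTransGen.refl p
  obtain ⟨b₁, hb₁⟩ := exists_budgetReach_iterate (inp := fun _ => inp p) hE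
    (A.init fun _ => inp p, b) p k
  obtain ⟨_, rfl⟩ := hA.validity _ _ p w hb₁.reach hw
  obtain ⟨b₂, hb₂⟩ := exists_budgetReach_iterate (inp := inp) hE (A.init inp, b) p k
  refine ⟨_, hb₂, p, ?_⟩
  have h : SameFor p (A.init inp) (A.init fun _ => inp p) := ⟨rfl, rfl, rfl⟩
  have := (h.iterate_advance k).loc
  unfold Outputs at hw ⊢
  rwa [this]

/-- The first steps of `p` and `q` after `x` can never be confused by any process. -/
def Opposed (A : Algorithm V (winnerType n) m) (E : Set (Event m)) (inp : Fin m → V)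
    (x : A.BudgetConfig) (p q : Fin m) : Prop :=
  ∀ y y' r, A.BudgetReach E inp (A.budgetAdvance p x) y →
    A.BudgetReach E inp (A.budgetAdvance q x) y' → ¬ SameFor r y.1 y'.1

theorem Opposed.symm {x : A.BudgetConfig} {p q : Fin m} (h : A.Opposed E inp x p q) :
    A.Opposed E inp x q p := fun y y' r hy hy' hs => h y' y r hy' hy hs.symm

/-- At a critical configuration each step of `p` leads to a single possible decision `val p`. If two
of these differ, a process confusing a continuation of one step with a continuation of the other
would decide the same value in both. -/
theorem Solves.exists_valency (hA : A.Solves E) (hE : Set.range Event.step ⊆ E) (hm : 2 ≤ m)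
    [Nontrivial V] :
    ∃ (inp : Fin m → V) (x : A.BudgetConfig) (val : Fin m → V),
      (∀ p v, ¬ A.Outputs x.1 p v) ∧ (∃ p q, val p ≠ val q) ∧
        ∀ p q, val p ≠ val q → A.Opposed E inp x p q := by
  obtain ⟨v₀, v₁, hv⟩ := exists_pair_ne V
  let inp : Fin m → V := fun i => if i = ⟨0, by omega⟩ then v₀ else v₁
  have hbiv : A.Bivalent E inp (A.init inp, 0) :=
    ⟨v₀, v₁, hv, by simpa [inp] using hA.canOutput_input (inp := inp) hE 0 ⟨0, by omega⟩,
      by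
      simpa [inp, Fin.ext_iff] using hA.canOutput_input (inp := inp) hE 0 ⟨1, by omega⟩⟩
  obtain ⟨x, hx, hbx, hcrit⟩ := hA.exists_critical rfl hbiv
  have hxr : A.Reach E inp (A.init inp) x.1 := hx.reach
  -- By agreement, an output already made at `x` would fix all later outputs.
  have hout : ∀ p v, ¬ A.Outputs x.1 p v := by
    intro p v hp
    obtain ⟨w, w', hne, ⟨y, hy, q, hq⟩, ⟨y', hy', q', hq'⟩⟩ := hbx
    exact hne ((hA.agreement inp _ _ _ _ _ _ hxr hy.reach hp hq).symm.trans
      (hA.agreement inp _ _ _ _ _ _ hxr hy'.reach hp hq'))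
  have hnext : ∀ p, A.BudgetNext E inp x (Event.step p) (A.budgetAdvance p x) := fun p =>
    budgetNext_advance hE (hout p)
  have huni : ∀ p, ¬ A.Bivalent E inp (A.budgetAdvance p x) := fun p => hcrit _ _ (hnext p)
  have hreach : ∀ p, A.BudgetReach E inp x (A.budgetAdvance p x) := fun p =>
    Relation.ReflTransGen.single ⟨_, hnext p⟩
  have hval : ∀ p, ∃ v, A.CanOutput E inp (A.budgetAdvance p x) v := fun p =>
    (hA.exists_common_output hE (hxr.trans (hreach p).reach) (r := p) ⟨rfl, rfl, rfl⟩).imp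
      fun _ h => h.1
  choose val hval using hval
  -- Crashes contribute no decisions beyond those of steps, so bivalence of `x` is already witnessed
  -- by two steps.
  have hex : ∀ v, A.CanOutput E inp x v → ∃ p, val p = v := by
    rintro v ⟨z, hz, q, hq⟩
    rcases Relation.ReflTransGen.cases_head hz with rfl | ⟨y, ⟨e, hy⟩, hyz⟩
    · exact absurd hq (hout q v)
    have hyv : A.CanOutput E inp y v := ⟨z, hyz, q, hq⟩
    have hyb := hcrit e y hy
    cases e with
    | step p =>
      have : y = A.budgetAdvance p x := Prod.ext (next_step_iff.1 hy.2.1).2 hy.2.2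
      subst this
      exact ⟨p, (hval p).eq hyv hyb⟩
    | crash i =>
      -- A crash of `i` commutes with a step of another process `p`, as far as `p` can see. The
      -- crash is still affordable after that step because steps never lower a budget. So the
      -- decision after the crash is `val p`.
      obtain ⟨p, hp⟩ : ∃ p : Fin m, p ≠ i := by
        have : Nontrivial (Fin m) := Fin.nontrivial_iff_two_le.2 hm
        exact exists_ne i
      refine ⟨p, ?_⟩
      obtain ⟨y₁, y₂⟩ := y
      obtain ⟨hiE, hn, hpos, hb⟩ := hy
      simp only at hn hb hpos
      have hloc : y₁ = { x.1 with loc := Function.update x.1.loc i (A.start i (inp i)) } := by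
        cases hn; rfl
      have hploc : y₁.loc p = x.1.loc p := by rw [hloc]; simp [Function.update_of_ne hp]
      have hpy : ∀ v, ¬ A.Outputs y₁ p v := fun v hv => hout p v (by
        unfold Outputs at hv ⊢; rwa [hploc] at hv)
      have h₁ : A.BudgetReach E inp (y₁, y₂) (A.budgetAdvance p (y₁, y₂)) :=
        Relation.ReflTransGen.single ⟨_, budgetNext_advance hE hpy⟩
      let z : A.BudgetConfig := ({ A.advance p x.1 with
          loc := Function.update (A.advance p x.1).loc i (A.start i (inp i)) },
        Function.update (budgetStep p x.2) i (budgetStep p x.2 i - 1))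
      have h₂ : A.BudgetReach E inp (A.budgetAdvance p x) z :=
        Relation.ReflTransGen.single ⟨Event.crash i, hiE, Next.crash _ _,
          lt_of_lt_of_le hpos (le_budgetStep _ _ _), rfl⟩
      have hsame₀ : SameFor p y₁ x.1 := ⟨by rw [hloc], by rw [hloc], hploc⟩
      have hsame : SameFor p (A.budgetAdvance p (y₁, y₂)).1 z.1 := by
        refine hsame₀.advance.trans ⟨rfl, rfl, ?_⟩
        simp [z, Function.update_of_ne hp]
      have hyr : A.Reach E inp (A.init inp) y₁ := hxr.tail ⟨_, hiE, hn⟩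
      obtain ⟨w, hw₁, hw₂⟩ := hA.exists_common_output hE (hyr.trans h₁.reach) hsame
      exact ((hval p).eq (hw₂.of_reach h₂) (huni p)).trans ((hw₁.of_reach h₁).eq hyv hyb)
  refine ⟨inp, x, val, hout, ?_, ?_⟩
  · obtain ⟨v, v', hne, hv, hv'⟩ := hbx
    obtain ⟨p, rfl⟩ := hex v hv
    obtain ⟨q, rfl⟩ := hex v' hv'
    exact ⟨p, q, hne⟩
  · intro p q hpq y y' r hy hy' hs
    obtain ⟨w, hw, hw'⟩ := hA.exists_common_output hE
      ((hxr.trans (hreach p).reach).trans hy.reach) hs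
    exact hpq (((hval p).eq (hw.of_reach hy) (huni p)).trans
      ((hw'.of_reach hy').eq (hval q) (huni q)))

/-- Process `p` is about to update object `o`. -/
def Updates (A : Algorithm V (winnerType n) m) (c : A.Config) (p : Fin m) (o : A.Obj) : Prop :=
  ∃ (i : Fin n) (k : Option (Fin n × ℕ) → A.Loc),
    A.code p (c.loc p) = Command.access (T := winnerType n) o (some i : Option (Fin n)) k

theorem Opposed.ne {x : A.BudgetConfig} {p q : Fin m} (h : A.Opposed E inp x p q) : p ≠ q := by
  rintro rfl
  exact h _ _ p Relation.ReflTransGen.refl Relation.ReflTransGen.refl ⟨rfl, rfl, rfl⟩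

theorem outputs_advance_of_ne {c : A.Config} {p q : Fin m} (h : q ≠ p)
    (hq : ∀ v, ¬ A.Outputs c q v) (v : V) : ¬ A.Outputs (A.advance p c) q v := by
  unfold Outputs
  rw [advance_loc_of_ne h]
  exact hq v

/-! ### Case analysis of two opposed steps -/

section Critical

open Classical

variable {x : A.BudgetConfig}

theorem budgetReach_advance_advance (hE : Set.range Event.step ⊆ E)
    (hout : ∀ p v, ¬ A.Outputs x.1 p v) {p q : Fin m} (h : q ≠ p) :
    A.BudgetReach E inp (A.budgetAdvance p x) (A.budgetAdvance q (A.budgetAdvance p x)) :=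
  Relation.ReflTransGen.single
    ⟨_, budgetNext_advance hE (outputs_advance_of_ne h (hout q))⟩

/-- A step opposed to another one changes the shared memory. -/
theorem Opposed.memory_ne (hE : Set.range Event.step ⊆ E) (hout : ∀ p v, ¬ A.Outputs x.1 p v)
    {p q : Fin m} (h : A.Opposed E inp x p q)
    (hobj : (A.advance p x.1).obj = x.1.obj) (hreg : (A.advance p x.1).reg = x.1.reg) : False := by
  refine h _ _ q (budgetReach_advance_advance hE hout h.ne.symm) Relation.ReflTransGen.refl ?_
  exact SameFor.advance ⟨hobj, hreg, advance_loc_of_ne h.ne.symm⟩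

/-- A third process has not moved and finds the same memory in both orders. -/
theorem Opposed.not_comm (hE : Set.range Event.step ⊆ E) (hout : ∀ p v, ¬ A.Outputs x.1 p v)
    (hm : 3 ≤ m) {p q : Fin m} (h : A.Opposed E inp x p q)
    (hobj : (A.advance q (A.advance p x.1)).obj = (A.advance p (A.advance q x.1)).obj)
    (hreg : (A.advance q (A.advance p x.1)).reg = (A.advance p (A.advance q x.1)).reg) :
    False := by
  obtain ⟨r, hr⟩ := Finset.exists_mem_notMem_of_card_lt_card
    (s := {p, q}) (t := (Finset.univ : Finset (Fin m)))
    (lt_of_le_of_lt Finset.card_le_two (by rw [Finset.card_fin]; omega))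
  simp only [Finset.mem_insert, Finset.mem_singleton, not_or] at hr
  refine h _ _ r (budgetReach_advance_advance hE hout h.ne.symm)
    (budgetReach_advance_advance hE hout h.ne) ⟨hobj, hreg, ?_⟩
  simp only [budgetAdvance]
  rw [advance_loc_of_ne hr.2.2, advance_loc_of_ne hr.2.1, advance_loc_of_ne hr.2.1,
    advance_loc_of_ne hr.2.2]

/-- Again a third process is the one that is confused, here after a single step on each side. -/
theorem Opposed.first_memory_ne (hm : 3 ≤ m) {p q : Fin m} (h : A.Opposed E inp x p q)
    (hobj : (A.advance p x.1).obj = (A.advance q x.1).obj)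
    (hreg : (A.advance p x.1).reg = (A.advance q x.1).reg) : False := by
  obtain ⟨r, hr⟩ := Finset.exists_mem_notMem_of_card_lt_card
    (s := {p, q}) (t := (Finset.univ : Finset (Fin m)))
    (lt_of_le_of_lt Finset.card_le_two (by rw [Finset.card_fin]; omega))
  simp only [Finset.mem_insert, Finset.mem_singleton, not_or] at hr
  refine h _ _ r Relation.ReflTransGen.refl Relation.ReflTransGen.refl ⟨hobj, hreg, ?_⟩
  simp only [budgetAdvance]
  rw [advance_loc_of_ne hr.2.2, advance_loc_of_ne hr.2.1]

/-- Opposed steps must change the memory, must not overwrite each other and must not commute. This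
excludes reads, writes and accesses to different objects. -/
theorem Opposed.updates (hE : Set.range Event.step ⊆ E) (hout : ∀ p v, ¬ A.Outputs x.1 p v)
    (hm : 3 ≤ m) {p q : Fin m} (h : A.Opposed E inp x p q) :
    ∃ o, A.Updates x.1 p o ∧ A.Updates x.1 q o ∧ x.1.obj o = (none : Option (Fin n × ℕ)) := by
  have hpq : (A.advance p x.1).loc q = x.1.loc q := advance_loc_of_ne h.ne.symm
  have hqp : (A.advance q x.1).loc p = x.1.loc p := advance_loc_of_ne h.ne
  have hq₂ : A.code q ((A.advance p x.1).loc q) = A.code q (x.1.loc q) := by rw [hpq]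
  have hp₂ : A.code p ((A.advance q x.1).loc p) = A.code p (x.1.loc p) := by rw [hqp]
  cases hp : A.code p (x.1.loc p) with
  | output v => exact absurd hp (hout p v)
  | read y k =>
    exact (h.memory_ne hE hout (by simp only [advance, hp]) (by simp only [advance, hp])).elim
  | write y a l =>
    cases hq : A.code q (x.1.loc q) with
    | output v => exact absurd hq (hout q v)
    | read y' k =>
      exact (h.symm.memory_ne hE hout (by simp only [advance, hq])
        (by simp only [advance, hq])).elim
    | write y' a' l' =>
      by_cases hy : y = y'
      · subst hy
        -- The write of `q` erases that of `p`, so `q` cannot tell whether `p` wrote before it.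
        refine (h _ _ q (budgetReach_advance_advance hE hout h.ne.symm)
          Relation.ReflTransGen.refl ⟨?_, ?_, ?_⟩).elim
        · rw [hq] at hq₂
          simp only [budgetAdvance]
          rw [advance.eq_def A q (A.advance p x.1), advance.eq_def A q x.1, hq₂, hq]
          simp only [advance, hp]
        · rw [hq] at hq₂
          simp only [budgetAdvance]
          rw [advance.eq_def A q (A.advance p x.1), advance.eq_def A q x.1, hq₂, hq]
          simp only [advance, hp, Function.update_idem]
        · rw [hq] at hq₂
          simp only [budgetAdvance]
          rw [advance.eq_def A q (A.advance p x.1), advance.eq_def A q x.1, hq₂, hq]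
          simp
      · rw [hq] at hq₂
        rw [hp] at hp₂
        refine (h.not_comm hE hout hm ?_ ?_).elim
        · rw [advance.eq_def A q (A.advance p x.1), advance.eq_def A p (A.advance q x.1), hq₂, hp₂]
          simp only [advance, hp, hq]
        · rw [advance.eq_def A q (A.advance p x.1), advance.eq_def A p (A.advance q x.1), hq₂, hp₂]
          simp only [advance, hp, hq]
          exact Function.update_comm hy _ _ _
    | access o op k =>
      rw [hq] at hq₂
      rw [hp] at hp₂
      refine (h.not_comm hE hout hm ?_ ?_).elim
      · rw [advance.eq_def A q (A.advance p x.1), advance.eq_def A p (A.advance q x.1), hq₂, hp₂]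
        simp only [advance, hp, hq]
      · rw [advance.eq_def A q (A.advance p x.1), advance.eq_def A p (A.advance q x.1), hq₂, hp₂]
        simp only [advance, hp, hq]
  | access o op k =>
    cases hq : A.code q (x.1.loc q) with
    | output v => exact absurd hq (hout q v)
    | read y' k =>
      exact (h.symm.memory_ne hE hout (by simp only [advance, hq])
        (by simp only [advance, hq])).elim
    | write y' a' l' =>
      rw [hq] at hq₂
      rw [hp] at hp₂
      refine (h.not_comm hE hout hm ?_ ?_).elim
      · rw [advance.eq_def A q (A.advance p x.1), advance.eq_def A p (A.advance q x.1), hq₂, hp₂]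
        simp only [advance, hp, hq]
      · rw [advance.eq_def A q (A.advance p x.1), advance.eq_def A p (A.advance q x.1), hq₂, hp₂]
        simp only [advance, hp, hq]
    | access o' op' k' =>
      by_cases ho : o = o'
      · subst ho
        rcases op with _ | i
        · exact (h.memory_ne hE hout (by simp [advance, hp, winnerNext])
            (by simp only [advance, hp])).elim
        rcases op' with _ | j
        · exact (h.symm.memory_ne hE hout (by simp [advance, hq, winnerNext])
            (by simp only [advance, hq])).elim
        refine ⟨o, ⟨i, k, hp⟩, ⟨j, k', hq⟩, ?_⟩
        -- In a state other than `none` the name is ignored, so both updates leave the same memory.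
        by_contra hne
        obtain ⟨s, hs⟩ := Option.ne_none_iff_exists'.1 hne
        refine h.first_memory_ne hm ?_ ?_
        · simp only [advance, hp, hq]
          rw [hs, winnerNext_some_eq n s i j]
        · simp only [advance, hp, hq]
      · rw [hq] at hq₂
        rw [hp] at hp₂
        refine (h.not_comm hE hout hm ?_ ?_).elim
        · rw [advance.eq_def A q (A.advance p x.1), advance.eq_def A p (A.advance q x.1), hq₂, hp₂]
          simp only [advance, hp, hq]
          exact (congrArg (fun s => Function.update (Function.update x.1.obj o _) o'
            (winnerNext n s op')) (Function.update_of_ne (Ne.symm ho) _ _)).trans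
            ((Function.update_comm ho _ _ _).trans
              (congrArg (fun s => Function.update (Function.update x.1.obj o' _) o
                (winnerNext n s op)) (Function.update_of_ne ho _ _).symm))
        · rw [advance.eq_def A q (A.advance p x.1), advance.eq_def A p (A.advance q x.1), hq₂, hp₂]
          simp only [advance, hp, hq]

end Critical

/-! ### Runs in which several processes take one step each -/

/-- The configuration after one step of each process in `l`. -/
noncomputable def budgetRun (A : Algorithm V (winnerType n) m) (l : List (Fin m))
    (x : A.BudgetConfig) : A.BudgetConfig :=
  l.foldl (fun y p => A.budgetAdvance p y) x

theorem budgetReach_budgetRun (hE : Set.range Event.step ⊆ E) {l : List (Fin m)} (hl : l.Nodup)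
    {x : A.BudgetConfig} (hout : ∀ p ∈ l, ∀ v, ¬ A.Outputs x.1 p v) :
    A.BudgetReach E inp x (A.budgetRun l x) := by
  induction l generalizing x with
  | nil => exact Relation.ReflTransGen.refl
  | cons p l ih =>
    rw [List.nodup_cons] at hl
    refine Relation.ReflTransGen.head
      ⟨_, budgetNext_advance hE (hout p (List.mem_cons_self ..))⟩ (ih hl.2 fun q hq => ?_)
    exact outputs_advance_of_ne (fun h => hl.1 (h ▸ hq)) (hout q (List.mem_cons_of_mem _ hq))

theorem le_budgetRun (l : List (Fin m)) (x : A.BudgetConfig) (i : Fin m) :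
    x.2 i ≤ (A.budgetRun l x).2 i := by
  induction l generalizing x with
  | nil => exact le_rfl
  | cons p l ih => exact (le_budgetStep p x.2 i).trans (ih (A.budgetAdvance p x))

/-- The step of `p` grants the credit, and a run without crashes spends none. -/
theorem budgetRun_pos {l : List (Fin m)} {p i : Fin m} (hp : p ∈ l) (hi : p < i)
    (x : A.BudgetConfig) : 0 < (A.budgetRun l x).2 i := by
  induction l generalizing x with
  | nil => cases hp
  | cons q l ih =>
    rcases List.mem_cons.1 hp with rfl | hp
    · refine lt_of_lt_of_le ?_ (le_budgetRun l (A.budgetAdvance p x) i)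
      simp [budgetAdvance, budgetStep, hi]
    · exact ih hp _

theorem budgetRun_loc {l : List (Fin m)} {r : Fin m} (hr : r ∉ l) (x : A.BudgetConfig) :
    (A.budgetRun l x).1.loc r = x.1.loc r := by
  induction l generalizing x with
  | nil => rfl
  | cons p l ih =>
    rw [List.mem_cons, not_or] at hr
    exact (ih hr.2 _).trans (advance_loc_of_ne hr.1)

theorem Updates.advance_of_ne {c : A.Config} {p q : Fin m} {o : A.Obj} (h : A.Updates c q o)
    (hqp : q ≠ p) : A.Updates (A.advance p c) q o := by
  unfold Updates
  rwa [advance_loc_of_ne hqp]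

theorem Updates.outputs {c : A.Config} {p : Fin m} {o : A.Obj} (h : A.Updates c p o) (v : V) :
    ¬ A.Outputs c p v := by
  obtain ⟨i, k, h⟩ := h
  intro hv
  rw [Outputs, h] at hv
  cases hv

open Classical in
theorem Updates.advance_memory {c : A.Config} {p : Fin m} {o : A.Obj} (h : A.Updates c p o) :
    ∃ i : Fin n, (A.advance p c).obj = Function.update c.obj o (winnerNext n (c.obj o) (some i)) ∧
      (A.advance p c).reg = c.reg := by
  obtain ⟨i, k, h⟩ := h
  exact ⟨i, by simp only [advance, h], by simp only [advance, h]⟩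

open Classical in
/-- Updates by `n - k` processes erase the memory of the object that has seen `k` updates. -/
theorem budgetRun_memory_some {l : List (Fin m)} (hl : l.Nodup) {x : A.BudgetConfig} {o : A.Obj}
    (hup : ∀ p ∈ l, A.Updates x.1 p o) {w : Fin n} {k : ℕ}
    (hs : x.1.obj o = (some (w, k) : Option (Fin n × ℕ))) (hk : k < n) (hlen : l.length + k = n) :
    (A.budgetRun l x).1.obj = Function.update x.1.obj o (none : Option (Fin n × ℕ)) ∧
      (A.budgetRun l x).1.reg = x.1.reg := by
  induction l generalizing x k with
  | nil => simp at hlen; omega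
  | cons p l ih =>
    rw [List.nodup_cons] at hl
    rw [List.length_cons] at hlen
    obtain ⟨i, hobj, hreg⟩ := (hup p (List.mem_cons_self ..)).advance_memory
    rw [hs] at hobj
    simp only [winnerNext] at hobj
    have hup' : ∀ q ∈ l, A.Updates (A.budgetAdvance p x).1 q o := fun q hq =>
      (hup q (List.mem_cons_of_mem _ hq)).advance_of_ne fun h => hl.1 (h ▸ hq)
    by_cases hk' : k + 1 < n
    · rw [if_pos hk'] at hobj
      have hs' : (A.budgetAdvance p x).1.obj o = (some (w, k + 1) : Option (Fin n × ℕ)) := by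
        exact (congrFun hobj o).trans (Function.update_self ..)
      obtain ⟨h₁, h₂⟩ := ih hl.2 hup' hs' hk' (by omega)
      refine ⟨h₁.trans ?_, h₂.trans hreg⟩
      exact (congrArg (fun f => Function.update f o (none : Option (Fin n × ℕ))) hobj).trans
        (Function.update_idem ..)
    · rw [if_neg hk'] at hobj
      obtain rfl : l = [] := List.length_eq_zero_iff.1 (by omega)
      exact ⟨hobj, hreg⟩

/-- Updates by `n` processes restore the initial state of the object. -/
theorem budgetRun_memory {l : List (Fin m)} (hl : l.Nodup) {x : A.BudgetConfig} {o : A.Obj}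
    (hup : ∀ p ∈ l, A.Updates x.1 p o) (hs : x.1.obj o = (none : Option (Fin n × ℕ)))
    (hn : 2 ≤ n) (hlen : l.length = n) :
    (A.budgetRun l x).1.obj = x.1.obj ∧ (A.budgetRun l x).1.reg = x.1.reg := by
  classical
  cases l with
  | nil => simp at hlen; omega
  | cons p l =>
    rw [List.nodup_cons] at hl
    rw [List.length_cons] at hlen
    obtain ⟨i, hobj, hreg⟩ := (hup p (List.mem_cons_self ..)).advance_memory
    rw [hs] at hobj
    simp only [winnerNext] at hobj
    have hup' : ∀ q ∈ l, A.Updates (A.budgetAdvance p x).1 q o := fun q hq =>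
      (hup q (List.mem_cons_of_mem _ hq)).advance_of_ne fun h => hl.1 (h ▸ hq)
    have hs' : (A.budgetAdvance p x).1.obj o = (some (i, 1) : Option (Fin n × ℕ)) := by
      exact (congrFun hobj o).trans (Function.update_self ..)
    -- The first update has set the count to `1`, so the remaining `n - 1` complete the cycle. The
    -- side goal `1 < n` is essential: an update in state `none` never resets.
    obtain ⟨h₁, h₂⟩ := budgetRun_memory_some hl.2 hup' hs' (by omega) hlen
    refine ⟨h₁.trans ?_, h₂.trans hreg⟩
    refine (congrArg (fun f => Function.update f o (none : Option (Fin n × ℕ))) hobj).trans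
      ((Function.update_idem ..).trans ?_)
    rw [← hs]
    exact Function.update_eq_self ..

/-- In every algorithm there is a configuration in which all processes are about to update the same
object in its initial state, and two of the updates are opposed. -/
theorem Solves.exists_opposed_updates (hA : A.Solves E) (hE : Set.range Event.step ⊆ E)
    (hm : 3 ≤ m) [Nontrivial V] :
    ∃ (inp : Fin m → V) (x : A.BudgetConfig) (o : A.Obj) (p q : Fin m),
      A.Opposed E inp x p q ∧ (∀ r, A.Updates x.1 r o) ∧
        x.1.obj o = (none : Option (Fin n × ℕ)) := by
  obtain ⟨inp, x, val, hout, ⟨p, q, hpq⟩, hopp⟩ := hA.exists_valency hE (by omega)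
  obtain ⟨o, hp, hq, hs⟩ := (hopp p q hpq).updates hE hout hm
  have huniq : ∀ {r o₁ o₂}, A.Updates x.1 r o₁ → A.Updates x.1 r o₂ → o₁ = o₂ := by
    rintro r o₁ o₂ ⟨i, k, h₁⟩ ⟨j, k', h₂⟩
    rw [h₁] at h₂
    injection h₂
  refine ⟨inp, x, o, p, q, hopp p q hpq, fun r => ?_, hs⟩
  -- Since `val p ≠ val q`, every `r` is opposed to `p` or to `q`, which ties its update to the
  -- object `o` of these two.
  by_cases hr : val r = val p
  · obtain ⟨o', hr', hq', -⟩ := (hopp r q (hr ▸ hpq)).updates hE hout hm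
    rwa [huniq hq hq']
  · obtain ⟨o', hr', hp', -⟩ := (hopp r p hr).updates hE hout hm
    rwa [huniq hp hp']

end Winner

end Algorithm

/-! ### The two impossibility results -/

/-- Choose `n` processes including `p` and `q`. Whichever of the two goes first, one update by each
restores the memory of `x`, and a process `r` outside the set sees exactly `x` in both cases. -/
theorem not_consensusSolvable_winnerType {V : Type} [Nontrivial V] {n m : ℕ} (hn : 3 ≤ n)
    (hm : n < m) : ¬ ConsensusSolvable V (winnerType n) m := by
  rintro ⟨A, hA⟩
  obtain ⟨inp, x, o, p, q, hpq, hup, hs⟩ := hA.exists_opposed_updates subset_rfl (by omega)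
  obtain ⟨S, hS, hcard⟩ := Finset.exists_superset_card_eq (s := ({p, q} : Finset (Fin m))) (n := n)
    (Finset.card_le_two.trans (by omega)) (by simpa using hm.le)
  obtain ⟨r, -, hr⟩ := Finset.exists_mem_notMem_of_card_lt_card
    (s := S) (t := Finset.univ) (by simpa [hcard] using hm)
  have run : ∀ p' q', p' ∈ S → q' ∈ S → p' ≠ q' →
      ∃ y, A.BudgetReach (Set.range Event.step) inp (A.budgetAdvance p' x) y ∧
        Algorithm.SameFor r y.1 x.1 := by
    intro p' _ hp' _ _
    have hl : (p' :: (S.erase p').toList).Nodup := by simp [Finset.nodup_toList]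
    have hrl : r ∉ p' :: (S.erase p').toList := by
      simp only [List.mem_cons, Finset.mem_toList, Finset.mem_erase, not_or]
      exact ⟨fun h => hr (h ▸ hp'), fun h => hr h.2⟩
    have hlen : (p' :: (S.erase p').toList).length = n := by
      rw [List.length_cons, Finset.length_toList, Finset.card_erase_of_mem hp', hcard]
      omega
    obtain ⟨hobj, hreg⟩ := Algorithm.budgetRun_memory hl (fun p _ => hup p) hs (by omega) hlen
    refine ⟨_, Algorithm.budgetReach_budgetRun subset_rfl (List.nodup_cons.1 hl).2 ?_,
      hobj, hreg, Algorithm.budgetRun_loc hrl x⟩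
    intro q hq
    exact ((hup q).advance_of_ne (by rintro rfl; simp at hq)).outputs
  obtain ⟨y, hy, hys⟩ := run p q (hS (by simp)) (hS (by simp)) hpq.ne
  obtain ⟨z, hz, hzs⟩ := run q p (hS (by simp)) (hS (by simp)) hpq.ne.symm
  exact hpq y z r hy hz (hys.trans hzs.symm)

/-- Here all `n` processes must update to restore the memory, so none is left uninformed. A crash of
`r` after the run makes it forget the response it received. -/
theorem not_recoverableConsensusSolvable_winnerType {V : Type} [Nontrivial V] {n : ℕ}
    (hn : 3 ≤ n) : ¬ RecoverableConsensusSolvable V (winnerType n) n := by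
  rintro ⟨A, hA⟩
  have hE : Set.range Event.step ⊆ (Set.univ : Set (Event n)) := Set.subset_univ _
  obtain ⟨inp, x, o, p, q, hpq, hup, hs⟩ := hA.exists_opposed_updates hE hn
  -- Process `1` may crash because process `0` steps in every such run; process `0` itself never
  -- earns a credit.
  let r : Fin n := ⟨1, by omega⟩
  have run : ∀ p', ∃ y, A.BudgetReach Set.univ inp (A.budgetAdvance p' x) y ∧
      y.1.obj = x.1.obj ∧ y.1.reg = x.1.reg ∧ y.1.loc r = A.start r (inp r) := by
    intro p'
    let l := p' :: (Finset.univ.erase p').toList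
    have hl : l.Nodup := by simp [l, Finset.nodup_toList]
    have hlen : l.length = n := by
      simp only [l, List.length_cons, Finset.length_toList,
        Finset.card_erase_of_mem (Finset.mem_univ p'), Finset.card_univ, Fintype.card_fin]
      omega
    obtain ⟨hobj, hreg⟩ := Algorithm.budgetRun_memory hl (fun p _ => hup p) hs (by omega) hlen
    have hreach : A.BudgetReach Set.univ inp (A.budgetAdvance p' x) (A.budgetRun l x) := by
      refine Algorithm.budgetReach_budgetRun hE (List.nodup_cons.1 hl).2 ?_
      intro q hq
      exact ((hup q).advance_of_ne (by rintro rfl; simp at hq)).outputs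
    have h₀ : (⟨0, by omega⟩ : Fin n) ∈ l := by
      by_cases h : (⟨0, by omega⟩ : Fin n) = p' <;> simp [l, h]
    refine ⟨({ (A.budgetRun l x).1 with
        loc := Function.update (A.budgetRun l x).1.loc r (A.start r (inp r)) }, _),
      hreach.tail ⟨Event.crash r, trivial, Algorithm.Next.crash _ _,
        Algorithm.budgetRun_pos h₀ (by simp [r]) x, rfl⟩, hobj, hreg, ?_⟩
    simp
  obtain ⟨y, hy, hyo, hyr, hyl⟩ := run p
  obtain ⟨z, hz, hzo, hzr, hzl⟩ := run q
  exact hpq y z r hy hz ⟨hyo.trans hzo.symm, hyr.trans hzr.symm, hyl.trans hzl.symm⟩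

theorem RecoverableConsensusSolvable.consensusSolvable {V : Type} {T : ObjType} {m : ℕ}
    (h : RecoverableConsensusSolvable V T m) : ConsensusSolvable V T m := by
  obtain ⟨A, hA⟩ := h
  have mono : ∀ {inp c c'}, A.Reach (Set.range Event.step) inp c c' → A.Reach Set.univ inp c c' :=
    fun {inp _ _} h => Relation.ReflTransGen.mono
      (r := fun c c' => ∃ e ∈ Set.range Event.step, A.Next inp c e c')
      (p := fun c c' => ∃ e ∈ Set.univ, A.Next inp c e c')
      (fun _ _ ⟨e, _, he⟩ => ⟨e, trivial, he⟩) _ _ h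
  exact ⟨A, fun inp c c' p p' v v' h h' => hA.agreement inp c c' p p' v v' (mono h) (mono h'),
    fun inp c p v h => hA.validity inp c p v (mono h),
    fun inp c e h₀ h => hA.waitFree inp c e h₀ fun t => ⟨trivial, (h t).2⟩⟩

/-! ### The consensus algorithm for `n` processes -/

/-- Local states of the consensus algorithm: announce the input, update the object, read the input
of the winner, output. -/
inductive WinnerLoc (n : ℕ) (V : Type) : Type
  | announce (v : V)
  | update (v : V)
  | read (w : Fin n)
  | done (v : V)

/-- The number of steps that remain to be taken. -/
def WinnerLoc.rank {n : ℕ} {V : Type} : WinnerLoc n V → ℕ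
  | announce _ => 3
  | update _ => 2
  | read _ => 1
  | done _ => 0

/-- The local state has been reached by updating the object. -/
def WinnerLoc.Updated {n : ℕ} {V : Type} : WinnerLoc n V → Prop
  | announce _ => False
  | update _ => False
  | read _ => True
  | done _ => True

/-- The consensus algorithm for `n` processes: the first process that updates the object wins. -/
noncomputable def winnerAlgorithm (V : Type) [Nontrivial V] (n : ℕ) :
    Algorithm V (winnerType n) n where
  Obj := Unit
  Reg := Fin n
  Val := V
  Loc := WinnerLoc n V
  initObj := fun _ => (none : Option (Fin n × ℕ))
  -- Without crashes this value is never read: only the register of the winner is read, and the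
  -- winner writes to it before updating.
  initReg := fun _ => Classical.arbitrary V
  start := fun _ v => WinnerLoc.announce v
  code := fun p l => match l with
    | WinnerLoc.announce v => Command.write p v (WinnerLoc.update v)
    -- The response is the old state: `none` means that this update came first, so the process
    -- decides its own input.
    | WinnerLoc.update v => Command.access (T := winnerType n) () (some p : Option (Fin n))
        fun s : Option (Fin n × ℕ) => s.elim (WinnerLoc.done v) fun r => WinnerLoc.read r.1
    | WinnerLoc.read w => Command.read w fun v => WinnerLoc.done v
    | WinnerLoc.done v => Command.output v

section WinnerAlgorithm

variable {V : Type} {n : ℕ}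

/-- The invariant of the consensus algorithm in terms of the set `D` of the processes that have
updated the object. -/
structure WinnerInv (inp : Fin n → V) (D : Finset (Fin n)) (s : Option (Fin n × ℕ))
    (reg : Fin n → V) (loc : Fin n → WinnerLoc n V) : Prop where
  mem_iff : ∀ p, p ∈ D ↔ (loc p).Updated
  announce : ∀ p v, loc p = WinnerLoc.announce v → v = inp p
  update : ∀ p v, loc p = WinnerLoc.update v → v = inp p
  reg_eq : ∀ p, (∀ v, loc p ≠ WinnerLoc.announce v) → reg p = inp p
  -- The guard `D.card < n` is needed because the `n`-th update resets the object; by then no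
  -- process will access it again.
  winner : (D = ∅ ∧ s = none) ∨ ∃ w ∈ D, (D.card < n → s = some (w, D.card)) ∧
    ∀ p ∈ D, loc p = WinnerLoc.read w ∨ loc p = WinnerLoc.done (inp w)

namespace WinnerInv

variable {inp : Fin n → V} {D : Finset (Fin n)} {s : Option (Fin n × ℕ)} {reg reg' : Fin n → V}
  {loc loc' : Fin n → WinnerLoc n V} {q : Fin n}

theorem write_step (h : WinnerInv inp D s reg loc) {v : V} (hl : loc q = WinnerLoc.announce v)
    (hl' : loc' q = WinnerLoc.update v) (hloc : ∀ p ≠ q, loc' p = loc p)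
    (hr' : reg' q = v) (hreg : ∀ p ≠ q, reg' p = reg p) : WinnerInv inp D s reg' loc' := by
  have hv := h.announce q v hl
  have hqD : q ∉ D := by rw [h.mem_iff, hl]; exact id
  refine ⟨fun p => ?_, fun p w hp => ?_, fun p w hp => ?_, fun p hp => ?_, ?_⟩
  · by_cases hpq : p = q
    · subst hpq; rw [hl', h.mem_iff, hl]; rfl
    · rw [hloc p hpq, h.mem_iff]
  · by_cases hpq : p = q
    · subst hpq; rw [hl'] at hp; cases hp
    · exact h.announce p w (hloc p hpq ▸ hp)
  · by_cases hpq : p = q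
    · subst hpq; rw [hl'] at hp; cases hp; exact hv
    · exact h.update p w (hloc p hpq ▸ hp)
  · by_cases hpq : p = q
    · subst hpq; rw [hr', hv]
    · rw [hreg p hpq]; exact h.reg_eq p (hloc p hpq ▸ hp)
  · refine h.winner.imp_right ?_
    rintro ⟨w, hw, hs, hD⟩
    refine ⟨w, hw, hs, fun p hp => ?_⟩
    rw [hloc p fun hpq => hqD (hpq ▸ hp)]
    exact hD p hp

theorem update_step (h : WinnerInv inp D s reg loc) {v : V}
    (hl : loc q = WinnerLoc.update v)
    (hl' : loc' q = s.elim (WinnerLoc.done v) fun r => WinnerLoc.read r.1)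
    (hloc : ∀ p ≠ q, loc' p = loc p) :
    WinnerInv inp (insert q D) (winnerNext n s (some q)) reg loc' := by
  have hv := h.update q v hl
  have hqD : q ∉ D := by rw [h.mem_iff, hl]; exact id
  have hcard : (insert q D).card = D.card + 1 := Finset.card_insert_of_notMem hqD
  -- The process `q` has not updated yet, so the object has not been reset and still shows the
  -- winner.
  have hlt : D.card < n := by
    have := Finset.card_le_univ (insert q D)
    rw [hcard, Fintype.card_fin] at this
    omega
  have hq : (∃ w, loc' q = WinnerLoc.read w) ∨ loc' q = WinnerLoc.done v := by
    rw [hl']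
    rcases s with _ | ⟨w, k⟩
    · exact Or.inr rfl
    · exact Or.inl ⟨w, rfl⟩
  refine ⟨fun p => ?_, fun p w hp => ?_, fun p w hp => ?_, fun p hp => ?_, ?_⟩
  · by_cases hpq : p = q
    · subst hpq
      simp only [Finset.mem_insert_self, true_iff]
      rcases hq with ⟨w, hq⟩ | hq <;> rw [hq] <;> trivial
    · rw [hloc p hpq, ← h.mem_iff, Finset.mem_insert, or_iff_right hpq]
  · by_cases hpq : p = q
    · subst hpq
      rcases hq with ⟨w, hq⟩ | hq <;> rw [hq] at hp <;> cases hp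
    · exact h.announce p w (hloc p hpq ▸ hp)
  · by_cases hpq : p = q
    · subst hpq
      rcases hq with ⟨w, hq⟩ | hq <;> rw [hq] at hp <;> cases hp
    · exact h.update p w (hloc p hpq ▸ hp)
  · by_cases hpq : p = q
    · subst hpq
      exact h.reg_eq p (by rw [hl]; rintro w ⟨⟩)
    · exact h.reg_eq p (hloc p hpq ▸ hp)
  · refine Or.inr ?_
    rcases h.winner with ⟨rfl, rfl⟩ | ⟨w, hw, hs, hD⟩
    · refine ⟨q, Finset.mem_insert_self _ _, fun _ => by simp [winnerNext], fun p hp => ?_⟩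
      obtain rfl : p = q := by simpa using hp
      exact Or.inr (by rw [hl', hv]; rfl)
    · obtain rfl := hs hlt
      refine ⟨w, Finset.mem_insert_of_mem hw, fun hlt' => ?_, fun p hp => ?_⟩
      · rw [hcard] at hlt' ⊢
        simp [winnerNext, hlt']
      · by_cases hpq : p = q
        · subst hpq
          exact Or.inl hl'
        · rw [hloc p hpq]
          exact hD p (Finset.mem_of_mem_insert_of_ne hp hpq)

theorem read_step (h : WinnerInv inp D s reg loc) {w : Fin n} (hl : loc q = WinnerLoc.read w)
    (hl' : loc' q = WinnerLoc.done (reg w)) (hloc : ∀ p ≠ q, loc' p = loc p) :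
    WinnerInv inp D s reg loc' := by
  have hqD : q ∈ D := by rw [h.mem_iff, hl]; trivial
  refine ⟨fun p => ?_, fun p w hp => ?_, fun p w hp => ?_, fun p hp => ?_, ?_⟩
  · by_cases hpq : p = q
    · subst hpq; rw [hl', h.mem_iff, hl]; rfl
    · rw [hloc p hpq, h.mem_iff]
  · by_cases hpq : p = q
    · subst hpq; rw [hl'] at hp; cases hp
    · exact h.announce p w (hloc p hpq ▸ hp)
  · by_cases hpq : p = q
    · subst hpq; rw [hl'] at hp; cases hp
    · exact h.update p w (hloc p hpq ▸ hp)
  · by_cases hpq : p = q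
    · subst hpq; exact h.reg_eq p (by rw [hl]; rintro w ⟨⟩)
    · exact h.reg_eq p (hloc p hpq ▸ hp)
  · refine h.winner.imp_right ?_
    rintro ⟨w', hw', hs, hD⟩
    refine ⟨w', hw', hs, fun p hp => ?_⟩
    by_cases hpq : p = q
    · subst hpq
      obtain rfl : w = w' := by
        rcases hD p hp with h | h <;> rw [hl] at h <;> cases h
        rfl
      -- The winner has updated, hence has already announced: its register holds its input.
      have hmem := (h.mem_iff w).1 hw'
      rw [hl', h.reg_eq w fun v hv => by rw [hv] at hmem; exact hmem]
      exact Or.inr rfl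
    · rw [hloc p hpq]
      exact hD p hp

theorem done_eq (h : WinnerInv inp D s reg loc) {w : Fin n} (hw : ∀ p ∈ D, loc p =
    WinnerLoc.read w ∨ loc p = WinnerLoc.done (inp w)) {p : Fin n} {v : V}
    (hp : loc p = WinnerLoc.done v) : v = inp w := by
  have hpD : p ∈ D := by rw [h.mem_iff, hp]; trivial
  rcases hw p hpD with h | h <;> rw [hp] at h <;> cases h
  rfl

theorem done_eq_done (h : WinnerInv inp D s reg loc) {p p' : Fin n} {v v' : V}
    (hp : loc p = WinnerLoc.done v) (hp' : loc p' = WinnerLoc.done v') : v = v' := by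
  rcases h.winner with ⟨rfl, -⟩ | ⟨w, -, -, hD⟩
  · have : p ∈ (∅ : Finset (Fin n)) := by rw [h.mem_iff, hp]; trivial
    simp at this
  · rw [h.done_eq hD hp, h.done_eq hD hp']

theorem exists_eq_input (h : WinnerInv inp D s reg loc) {p : Fin n} {v : V}
    (hp : loc p = WinnerLoc.done v) : ∃ w, inp w = v := by
  rcases h.winner with ⟨rfl, -⟩ | ⟨w, -, -, hD⟩
  · have : p ∈ (∅ : Finset (Fin n)) := by rw [h.mem_iff, hp]; trivial
    simp at this
  · exact ⟨w, (h.done_eq hD hp).symm⟩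

end WinnerInv

variable [Nontrivial V]

/-- The steps of the consensus algorithm. -/
theorem winnerAlgorithm_next {inp : Fin n → V} {c c' : (winnerAlgorithm V n).Config} {q : Fin n}
    (h : (winnerAlgorithm V n).Next inp c (Event.step q) c') :
    (∃ v : V, c.loc q = WinnerLoc.announce v ∧ c'.loc q = WinnerLoc.update v ∧
      c'.obj () = c.obj () ∧ c'.reg q = v ∧ ∀ p ≠ q, c'.reg p = c.reg p) ∨
    (∃ v : V, c.loc q = WinnerLoc.update v ∧
      c'.loc q = Option.elim (α := Fin n × ℕ) (c.obj ()) (WinnerLoc.done v)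
        (fun r => WinnerLoc.read r.1) ∧
      c'.obj () = winnerNext n (c.obj ()) (some q) ∧ c'.reg = c.reg) ∨
    ∃ w : Fin n, c.loc q = WinnerLoc.read w ∧ c'.loc q = WinnerLoc.done (c.reg w) ∧
      c'.obj () = c.obj () ∧ c'.reg = c.reg := by
  obtain ⟨hout, rfl⟩ := Algorithm.next_step_iff.1 h
  have hl : ∃ l : WinnerLoc n V, c.loc q = l := ⟨_, rfl⟩
  obtain ⟨l, hl⟩ := hl
  cases l with
  | announce v =>
    have hcode : (winnerAlgorithm V n).code q (c.loc q) =
        Command.write (q : Fin n) v (WinnerLoc.update v) := by rw [hl]; rfl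
    refine Or.inl ⟨v, hl, ?_⟩
    simp only [Algorithm.advance, hcode]
    exact ⟨@Function.update_self _ _ (_) _ _ _, trivial, @Function.update_self _ _ (_) _ _ _,
      fun p hp => @Function.update_of_ne _ _ (_) _ _ hp _ _⟩
  | update v =>
    have hcode : (winnerAlgorithm V n).code q (c.loc q) =
        Command.access (T := winnerType n) () (some q : Option (Fin n))
          fun s : Option (Fin n × ℕ) => s.elim (WinnerLoc.done v) fun r => WinnerLoc.read r.1 := by
      rw [hl]; rfl
    refine Or.inr (Or.inl ⟨v, hl, ?_⟩)
    simp only [Algorithm.advance, hcode]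
    exact ⟨@Function.update_self _ _ (_) _ _ _, @Function.update_self _ _ (_) _ _ _, trivial⟩
  | read w =>
    have hcode : (winnerAlgorithm V n).code q (c.loc q) =
        Command.read (w : Fin n) fun v => WinnerLoc.done v := by rw [hl]; rfl
    refine Or.inr (Or.inr ⟨w, hl, ?_⟩)
    simp only [Algorithm.advance, hcode]
    exact ⟨@Function.update_self _ _ (_) _ _ _, trivial, trivial⟩
  | done v =>
    refine absurd ?_ (hout v)
    unfold Algorithm.Outputs
    rw [hl]
    rfl

theorem winnerAlgorithm_loc_of_ne {inp : Fin n → V} {c c' : (winnerAlgorithm V n).Config}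
    {q : Fin n} (h : (winnerAlgorithm V n).Next inp c (Event.step q) c') (p : Fin n)
    (hp : p ≠ q) : c'.loc p = c.loc p := by
  obtain ⟨-, rfl⟩ := Algorithm.next_step_iff.1 h
  exact Algorithm.advance_loc_of_ne hp

theorem winnerAlgorithm_inv_of_reach {inp : Fin n → V}
    {c₀ c : (winnerAlgorithm V n).Config} (h₀ : ∃ D, WinnerInv inp D (c₀.obj ()) c₀.reg c₀.loc)
    (h : (winnerAlgorithm V n).Reach (Set.range Event.step) inp c₀ c) :
    ∃ D, WinnerInv inp D (c.obj ()) c.reg c.loc := by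
  induction h with
  | refl => exact h₀
  | tail _ hstep ih =>
    obtain ⟨D, hD⟩ := ih
    obtain ⟨_, ⟨q, rfl⟩, hnext⟩ := hstep
    have hloc := winnerAlgorithm_loc_of_ne hnext
    rcases winnerAlgorithm_next hnext with ⟨v, hl, hl', hs, hr, hreg⟩ | ⟨v, hl, hl', hs, hreg⟩ |
      ⟨w, hl, hl', hs, hreg⟩
    · exact ⟨D, hs ▸ hD.write_step hl hl' hloc hr hreg⟩
    · exact ⟨insert q D, hs ▸ hreg ▸ hD.update_step hl hl' hloc⟩
    · exact ⟨D, hs ▸ hreg ▸ hD.read_step hl hl' hloc⟩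

theorem winnerAlgorithm_inv {inp : Fin n → V} {c : (winnerAlgorithm V n).Config}
    (h : (winnerAlgorithm V n).Reach (Set.range Event.step) inp
      ((winnerAlgorithm V n).init inp) c) :
    ∃ D, WinnerInv inp D (c.obj ()) c.reg c.loc := by
  refine winnerAlgorithm_inv_of_reach ⟨∅, fun p => ?_, fun p v hv => ?_, fun p v hv => ?_,
    fun p hp => ?_, Or.inl ⟨rfl, rfl⟩⟩ h
  · exact iff_of_false (Finset.notMem_empty p) id
  · cases hv; rfl
  · cases hv
  · exact absurd rfl (hp (inp p))

theorem winnerAlgorithm_rank {inp : Fin n → V} {c c' : (winnerAlgorithm V n).Config} {q : Fin n}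
    (h : (winnerAlgorithm V n).Next inp c (Event.step q) c') :
    WinnerLoc.rank (c'.loc q) < WinnerLoc.rank (c.loc q) := by
  rcases winnerAlgorithm_next h with ⟨v, hl, hl', -⟩ | ⟨v, hl, hl', -⟩ | ⟨w, hl, hl', -⟩
  · rw [hl, hl']; simp [WinnerLoc.rank]
  · rw [hl, hl']
    cases (c.obj () : Option (Fin n × ℕ)) <;> simp [WinnerLoc.rank]
  · rw [hl, hl']; simp [WinnerLoc.rank]

theorem winnerAlgorithm_outputs {c : (winnerAlgorithm V n).Config} {p : Fin n} {v : V}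
    (h : (winnerAlgorithm V n).Outputs c p v) : c.loc p = WinnerLoc.done v := by
  unfold Algorithm.Outputs at h
  have hl : ∃ l : WinnerLoc n V, c.loc p = l := ⟨_, rfl⟩
  obtain ⟨l, hl⟩ := hl
  rw [hl] at h ⊢
  cases l <;> cases h
  rfl

theorem winnerAlgorithm_done_of_reach {inp : Fin n → V}
    {c c' : (winnerAlgorithm V n).Config} {p : Fin n} {v : V} (hp : c.loc p = WinnerLoc.done v)
    (h : (winnerAlgorithm V n).Reach (Set.range Event.step) inp c c') :
    c'.loc p = WinnerLoc.done v := by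
  induction h with
  | refl => exact hp
  | tail _ hstep ih =>
    obtain ⟨_, ⟨q, rfl⟩, hnext⟩ := hstep
    by_cases hpq : p = q
    · subst hpq
      refine absurd ?_ ((Algorithm.next_step_iff.1 hnext).1 v)
      unfold Algorithm.Outputs
      rw [ih]
      rfl
    · rw [winnerAlgorithm_loc_of_ne hnext p hpq, ih]

end WinnerAlgorithm

theorem consensusSolvable_winnerType (V : Type) [Nontrivial V] (n : ℕ) :
    ConsensusSolvable V (winnerType n) n := by
  refine ⟨winnerAlgorithm V n, ?_, ?_, ?_⟩
  · intro inp c c' p p' v v' h h' hv hv'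
    obtain ⟨D, hD⟩ := winnerAlgorithm_inv (h.trans h')
    exact hD.done_eq_done (winnerAlgorithm_done_of_reach (winnerAlgorithm_outputs hv) h')
      (winnerAlgorithm_outputs hv')
  · intro inp c p v h hv
    obtain ⟨D, hD⟩ := winnerAlgorithm_inv h
    exact hD.exists_eq_input (winnerAlgorithm_outputs hv)
  · intro inp c e _ h p _
    refine Set.finite_of_antitone_of_lt (f := fun t => WinnerLoc.rank ((c t).loc p))
      (antitone_nat_of_succ_le fun t => ?_) fun t ht => ?_
    · obtain ⟨⟨q, hq⟩, hnext⟩ := h t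
      rw [← hq] at hnext
      by_cases hpq : p = q
      · subst hpq
        exact (winnerAlgorithm_rank hnext).le
      · exact (congrArg WinnerLoc.rank (winnerAlgorithm_loc_of_ne hnext p hpq)).le
    · have hnext := (h t).2
      rw [show e t = Event.step p from ht] at hnext
      exact winnerAlgorithm_rank hnext

theorem mainTheorem6 (n : ℕ) (hn : 4 ≤ n) :
    ∃ T : ObjType, T.Deterministic ∧ T.Readable ∧
      ∀ (V : Type) [Nontrivial V], rcons V T < cons V T ∧ cons V T = (n : ℕ∞) := by
  refine ⟨winnerType n, winnerType_deterministic n, winnerType_readable n, fun V _ => ?_⟩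
  have hcons : cons V (winnerType n) = (n : ℕ∞) := by
    refine le_antisymm (iSup₂_le fun m hm => ?_)
      (le_iSup₂ (f := fun (m : ℕ) (_ : ConsensusSolvable V (winnerType n) m) => (m : ℕ∞)) n
        (consensusSolvable_winnerType V n))
    by_contra h
    exact not_consensusSolvable_winnerType (by omega) (by simpa using h) hm
  have hrcons : rcons V (winnerType n) ≤ ((n - 1 : ℕ) : ℕ∞) := by
    refine iSup₂_le fun m hm => ?_
    -- No monotonicity in the number of processes is needed: `m = n` is excluded by crashes, and
    -- every `m > n` already without them.
    have hmn : m ≠ n := by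
      rintro rfl
      exact not_recoverableConsensusSolvable_winnerType (by omega) hm
    have hle : m ≤ n := by
      by_contra h
      exact not_consensusSolvable_winnerType (by omega) (by omega) hm.consensusSolvable
    exact_mod_cast (by omega : m ≤ n - 1)
  refine ⟨?_, hcons⟩
  rw [hcons]
  exact hrcons.trans_lt (by exact_mod_cast (by omega : n - 1 < n))
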